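/- Let $n\ge 1$ and let the edges of the complete graph $K_n$ be colored so that exactly $n$ colors appear. Call a subgraph properly colored if any two of its edges that share an endpoint have different colors. If the coloring contains no properly colored (not necessarily induced) cycle $C_4$, then at least one of the following holds. (1) There is a vertex all of whose incident edges have the same color. (2) There is a rainbow triangle $uvw$, i.e. three vertices such that the colors of $uv$, $vw$, $uw$ are pairwise distinct, such that every edge from $u$ to a vertex outside the triangle has the color of $uv$, every edge from $v$ to a vertex outside the triangle has the color of $vw$, and every edge from $w$ to a vertex outside the triangle has the color of $uw$. (3) There is a vertex $v$ whose incident edges have pairwise distinct colors, while all edges not incident with $v$ have one common color, and this color is different from the colors of all edges incident with $v$. -/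

import Mathlib

/-- A subgraph `H` of the edge-coloured graph `(G, c)` is properly coloured: any two distinct
edges of `H` that share an endpoint have different colours. -/
def IsProperlyColored {V C : Type*} {G : SimpleGraph V} (c : G.EdgeLabeling C)
    (H : G.Subgraph) : Prop :=
  ∀ e f : G.edgeSet, (e : Sym2 V) ∈ H.edgeSet → (f : Sym2 V) ∈ H.edgeSet → e ≠ f →
    (∃ x : V, x ∈ (e : Sym2 V) ∧ x ∈ (f : Sym2 V)) → c e ≠ c f

/-- The edge-coloured graph `(G, c)` contains a properly coloured `C₄`: some subgraph of `G`
is isomorphic to the 4-cycle and properly coloured. -/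
def ContainsProperlyColoredC4 {V C : Type*} {G : SimpleGraph V} (c : G.EdgeLabeling C) : Prop :=
  ∃ H : G.Subgraph, Nonempty (SimpleGraph.cycleGraph 4 ≃g H.coe) ∧ IsProperlyColored c H

/-- The number of colours appearing on the edges of `(G, c)`. -/
noncomputable def numColors {V C : Type*} {G : SimpleGraph V} (c : G.EdgeLabeling C) : ℕ :=
  (Set.range c).ncard

/-- Structure (1): a vertex all of whose incident edges have a single colour. -/
def HasMonochromaticVertex {V C : Type*} (c : SimpleGraph.TopEdgeLabeling V C) : Prop :=
  ∃ (v : V) (a : C), ∀ (x : V) (h : v ≠ x), c.get v x h = a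

/-- Structure (2): a triangle `uvw` with `uv` red, `vw` blue, `uw` green, three different colours,
such that all other edges at `u` are red, all other edges at `v` are blue, and all other edges
at `w` are green. -/
def HasRainbowTriangleStructure {V C : Type*} (c : SimpleGraph.TopEdgeLabeling V C) : Prop :=
  ∃ (u v w : V) (huv : u ≠ v) (hvw : v ≠ w) (huw : u ≠ w) (red blue green : C),
    red ≠ blue ∧ blue ≠ green ∧ red ≠ green ∧
    c.get u v huv = red ∧ c.get v w hvw = blue ∧ c.get u w huw = green ∧
    (∀ (x : V) (h : u ≠ x), x ≠ v → x ≠ w → c.get u x h = red) ∧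
    (∀ (x : V) (h : v ≠ x), x ≠ u → x ≠ w → c.get v x h = blue) ∧
    (∀ (x : V) (h : w ≠ x), x ≠ u → x ≠ v → c.get w x h = green)

/-- Structure (3): a vertex `v` whose incident edges have pairwise distinct colours, while all
edges avoiding `v` have one single colour `a`, which is distinct from the colours of the edges
at `v`. -/
def HasRainbowStarStructure {V C : Type*} (c : SimpleGraph.TopEdgeLabeling V C) : Prop :=
  ∃ (v : V) (a : C),
    (∀ (x y : V) (hx : v ≠ x) (hy : v ≠ y), x ≠ y → c.get v x hx ≠ c.get v y hy) ∧
    (∀ (x y : V) (h : x ≠ y), x ≠ v → y ≠ v → c.get x y h = a) ∧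
    (∀ (x : V) (h : v ≠ x), c.get v x h ≠ a)

/-! Orient an edge `vz` from `v` when its colour occurs only at `v` (`IsPrivate`); an edge oriented
both ways has a colour of its own. Without a proper 4-cycle, directed 3-paths have shortcuts, so a
minimal out-degree argument yields a vertex whose private edges all have unique colours
(`exists_private_symm`). Deleting it costs at most one colour, or it has two such edges `vx`, `vy`
and the colours can be counted directly. Hence `n` vertices carry at most `n` colours.

With exactly `n` colours every vertex has a private edge, and two unique colours meet at some `v`
(`exists_two_unique`). The count is then tight: the colours at `v` are distinct and `xy` has the
only other one. Let `T` be the vertices sending to `x` the colour they send to `v`. If `T` is empty,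
(3) holds. Otherwise each edge inside `T` repeats the `v`-colour of one end, which makes `T` a
tournament whose members dominate everything outside; a source gives (1), a dominating cyclic
triangle gives (2). -/

/-- No 4-cycle is properly coloured by the symmetric edge colouring `f`. -/
def NoProperC4 {V C : Type*} (f : V → V → C) : Prop :=
  ∀ a b c d, a ≠ b → a ≠ c → a ≠ d → b ≠ c → b ≠ d → c ≠ d →
    f a b = f b c ∨ f b c = f c d ∨ f c d = f d a ∨ f d a = f a b

/-! ### Private colours and their digraph -/

/-- `v` and `z` are distinct vertices of `S`, and every edge inside `S` with the colour of `vz`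
contains `v`. -/
def IsPrivate {V C : Type*} (f : V → V → C) (S : Finset V) (v z : V) : Prop :=
  v ∈ S ∧ z ∈ S ∧ v ≠ z ∧ ∀ p ∈ S, ∀ q ∈ S, p ≠ q → f p q = f v z → p = v ∨ q = v

/-- The colours of the edges inside `S`. -/
noncomputable def edgeColors {V C : Type*} (f : V → V → C) (S : Finset V) : Finset C := by
  classical exact S.offDiag.image fun p => f p.1 p.2

theorem mem_edgeColors {V C : Type*} {f : V → V → C} {S : Finset V} {a : C} :
    a ∈ edgeColors f S ↔ ∃ x ∈ S, ∃ y ∈ S, x ≠ y ∧ f x y = a := by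
  simp only [edgeColors, Finset.mem_image, Finset.mem_offDiag, Prod.exists]
  grind

/-- The colour of an edge which is private to both its ends occurs only on that edge. -/
theorem IsPrivate.unique {V C : Type*} {f : V → V → C} {S : Finset V} {v z : V}
    (h : IsPrivate f S v z) (h' : IsPrivate f S z v) (hs : ∀ x y, f x y = f y x)
    {p q : V} (hp : p ∈ S) (hq : q ∈ S) (hpq : p ≠ q) (e : f p q = f v z) :
    (p = v ∧ q = z) ∨ (p = z ∧ q = v) := by
  have h1 := h.2.2.2 p hp q hq hpq e
  have h2 := h'.2.2.2 p hp q hq hpq (e.trans (hs v z))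
  have := h.2.2.1
  grind

theorem IsPrivate.of_color_eq {V C : Type*} {f : V → V → C} {S : Finset V} {v z t : V}
    (h : IsPrivate f S v z) (ht : t ∈ S) (hvt : v ≠ t) (e : f v t = f v z) :
    IsPrivate f S v t :=
  ⟨h.1, ht, hvt, fun p hp q hq hpq h' => h.2.2.2 p hp q hq hpq (h'.trans e)⟩

/-- A directed path of three private edges is shortcut by an edge with the colour of its
first edge. -/
theorem NoProperC4.color_eq_of_path {V C : Type*} {f : V → V → C} {S : Finset V}
    (hC : NoProperC4 f) (hs : ∀ x y, f x y = f y x) {v₁ v₂ v₃ v₄ : V}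
    (h₁ : IsPrivate f S v₁ v₂) (h₂ : IsPrivate f S v₂ v₃) (h₃ : IsPrivate f S v₃ v₄)
    (h13 : v₁ ≠ v₃) (h14 : v₁ ≠ v₄) (h24 : v₂ ≠ v₄) : f v₁ v₄ = f v₁ v₂ := by
  obtain ⟨m1, m2, n1, p1⟩ := h₁
  obtain ⟨-, m3, n2, p2⟩ := h₂
  obtain ⟨-, m4, n3, p3⟩ := h₃
  have e := hs v₄ v₁
  have a1 := p1 v₂ m2 v₃ m3 n2
  have a2 := p2 v₃ m3 v₄ m4 n3
  have a3 := p3 v₁ m1 v₄ m4 h14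
  -- Privacy at the tails excludes every coincidence of consecutive colours except that of `v₄v₁`
  -- with `v₁v₂`.
  rcases hC v₁ v₂ v₃ v₄ n1 h13 h14 n2 h24 n3 with h | h | h | h <;> grind

/-- In a nonempty vertex set some vertex has no private edge whose colour occurs elsewhere. -/
theorem NoProperC4.exists_private_symm {V C : Type*} {f : V → V → C} {S : Finset V}
    (hC : NoProperC4 f) (hs : ∀ x y, f x y = f y x) (hS : S.Nonempty) :
    ∃ v ∈ S, ∀ z, IsPrivate f S v z → IsPrivate f S z v := by
  classical
  let U : V → Finset V := fun v => S.filter fun z => IsPrivate f S v z ∧ ¬ IsPrivate f S z v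
  have hU : ∀ v z, z ∈ U v ↔ IsPrivate f S v z ∧ ¬ IsPrivate f S z v := fun v z => by
    simp only [U, Finset.mem_filter, and_iff_right_iff_imp]
    exact fun h => h.1.2.1
  by_contra! hne
  -- an asymmetric private edge forces all edges with its colour to be asymmetric
  have hcol : ∀ v z t, z ∈ U v → t ∈ S → v ≠ t → f v t = f v z → t ∈ U v := by
    intro v z t hz ht hvt e
    rw [hU] at hz ⊢
    refine ⟨hz.1.of_color_eq ht hvt e, fun h => hz.2 ?_⟩
    have := (hz.1.of_color_eq ht hvt e).unique h hs hz.1.1 hz.1.2.1 hz.1.2.2.1 e.symm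
    grind
  have hpath : ∀ v₁ v₂ v₃ v₄, v₂ ∈ U v₁ → v₃ ∈ U v₂ → v₄ ∈ U v₃ → v₁ ≠ v₄ → v₂ ≠ v₄ →
      v₄ ∈ U v₁ := by
    intro v₁ v₂ v₃ v₄ h1 h2 h3 h14 h24
    have k1 := (hU _ _).1 h1
    have k2 := (hU _ _).1 h2
    have k3 := (hU _ _).1 h3
    have h13 : v₁ ≠ v₃ := by rintro rfl; exact k1.2 k2.1
    exact hcol _ _ _ h1 k3.1.2.1 h14
      (hC.color_eq_of_path hs k1.1 k2.1 k3.1 h13 h14 h24)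
  obtain ⟨v, hvS, hmin⟩ := S.exists_min_image (fun v => (U v).card) hS
  obtain ⟨u, hu1, hu2⟩ := hne v hvS
  have hu : u ∈ U v := (hU _ _).2 ⟨hu1, hu2⟩
  have hasymm : ∀ p q, q ∈ U p → p ∉ U q := fun p q h h' =>
    ((hU _ _).1 h).2 ((hU _ _).1 h').1
  -- Shortcuts put `U w`, up to `v`, inside `U v` without `u`; minimality of `U v` leaves no slack.
  have hback : ∀ w, w ∈ U u → v ∈ U w ∧ (U w).erase v = (U v).erase u := by
    intro w hw
    have hsub : (U w).erase v ⊆ (U v).erase u := by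
      intro t ht
      obtain ⟨htv, ht⟩ := Finset.mem_erase.1 ht
      have htu : t ≠ u := by rintro rfl; exact hasymm _ _ hw ht
      exact Finset.mem_erase.2 ⟨htu, hpath v u w t hu hw ht htv.symm htu.symm⟩
    have hle := hmin w ((hU _ _).1 hw).1.2.1
    have hpos := Finset.card_pos.2 ⟨u, hu⟩
    have hvw : v ∈ U w := by
      by_contra hvw
      have := Finset.card_le_card hsub
      rw [Finset.erase_eq_of_notMem hvw, Finset.card_erase_of_mem hu] at this
      omega
    refine ⟨hvw, Finset.eq_of_subset_of_card_le hsub ?_⟩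
    rw [Finset.card_erase_of_mem hu, Finset.card_erase_of_mem hvw]
    omega
  obtain ⟨w, hw1, hw2⟩ := hne u hu1.2.1
  have hw : w ∈ U u := (hU _ _).2 ⟨hw1, hw2⟩
  obtain ⟨hvw, heq⟩ := hback w hw
  -- If `u` were the only member of `U v`, the colour of `vu` would occur once and be private to `u`
  -- too.
  obtain ⟨z, hz, hzu⟩ : ∃ z ∈ U v, z ≠ u := by
    by_contra! hall
    refine hu2 ⟨hu1.2.1, hu1.1, hu1.2.2.1.symm, fun p hp q hq hpq e => ?_⟩
    have e' : f p q = f v u := e.trans (hs u v)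
    rcases hu1.2.2.2 p hp q hq hpq e' with rfl | rfl
    · exact Or.inr (hall q (hcol _ u _ hu hq hpq e'))
    · exact Or.inl (hall p (hcol _ u _ hu hp hpq.symm ((hs _ _).trans e')))
  have hzw : z ≠ w := by rintro rfl; exact hasymm _ _ hz hvw
  exact hasymm _ _ hz (hback z (hpath u w v z hw hvw hz hzu.symm hzw.symm)).1

/-! ### At most as many colours as vertices -/

/-- If two edges `vx` and `vy` have colours occurring nowhere else, then each remaining vertex sends
one colour to `x` and `y`, which is the colour of its edge to `v` or that of `xy`, and the colour
of an edge between two remaining vertices is restricted by those of their edges to `v` and `x`. -/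
theorem NoProperC4.structure_of_unique {V C : Type*} {f : V → V → C} {S : Finset V}
    (hC : NoProperC4 f) (hs : ∀ x y, f x y = f y x) {v x y : V} (hxy : x ≠ y)
    (hvx : IsPrivate f S v x) (hxv : IsPrivate f S x v)
    (hvy : IsPrivate f S v y) (hyv : IsPrivate f S y v) :
    (∀ w ∈ S, w ≠ v → w ≠ x → w ≠ y → f w x = f w y ∧ (f w x = f w v ∨ f w x = f x y)) ∧
    (∀ w ∈ S, w ≠ v → w ≠ x → w ≠ y → ∀ w' ∈ S, w' ≠ v → w' ≠ x → w' ≠ y → w ≠ w' →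
      f w w' = f w' x ∨ f w w' = f w v) := by
  have hx := hvx.2.1
  have hy := hvy.2.1
  have hv := hvx.1
  have nvx := hvx.2.2.1
  have nvy := hvy.2.2.1
  have ux : ∀ p q, p ∈ S → q ∈ S → p ≠ q → f p q = f v x → _ :=
    fun p q hp hq hpq => hvx.unique hxv hs hp hq hpq
  have uy : ∀ p q, p ∈ S → q ∈ S → p ≠ q → f p q = f v y → _ :=
    fun p q hp hq hpq => hvy.unique hyv hs hp hq hpq
  have key : ∀ w ∈ S, w ≠ v → w ≠ x → w ≠ y → f w x = f w y := by
    intro w hw wv wx wy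
    have := hC w x v y wx wv wy nvx.symm hxy nvy
    have := ux w x hw hx wx
    have := ux v y hv hy nvy
    have := uy y w hy hw wy.symm
    have := hs y w
    have := hs v x
    grind
  refine ⟨fun w hw wv wx wy => ⟨key w hw wv wx wy, ?_⟩, ?_⟩
  · have := hC w v x y wv wx wy nvx nvy hxy
    have := ux w v hw hv wv
    have := ux x y hx hy hxy
    have := hs y w
    have := key w hw wv wx wy
    grind
  · intro w hw wv wx wy w' hw' wv' wx' wy' hww
    have := hC w w' x v hww wx wv wx' wv' nvx.symm
    have := ux w' x hw' hx wx'
    have := ux v w hv hw wv.symm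
    have := hs v x
    have := hs v w
    grind

theorem NoProperC4.edgeColors_subset_of_unique {V C : Type*} [DecidableEq V] [DecidableEq C]
    {f : V → V → C} {S : Finset V}
    (hC : NoProperC4 f) (hs : ∀ x y, f x y = f y x) {v x y : V} (hxy : x ≠ y)
    (hvx : IsPrivate f S v x) (hxv : IsPrivate f S x v)
    (hvy : IsPrivate f S v y) (hyv : IsPrivate f S y v) :
    edgeColors f S ⊆ insert (f x y) ((S.erase v).image (f v)) := by
  obtain ⟨h1, h2⟩ := hC.structure_of_unique hs hxy hvx hxv hvy hyv
  intro a ha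
  obtain ⟨p, hp, q, hq, hpq, rfl⟩ := mem_edgeColors.1 ha
  have hv : ∀ z ∈ S, z ≠ v → f z v ∈ insert (f x y) ((S.erase v).image (f v)) := by
    intro z hz hzv
    exact Finset.mem_insert_of_mem (Finset.mem_image.2 ⟨z, Finset.mem_erase.2 ⟨hzv, hz⟩, hs v z⟩)
  have hx : ∀ z ∈ S, z ≠ v → z ≠ x → z ≠ y →
      f z x ∈ insert (f x y) ((S.erase v).image (f v)) := by
    intro z hz hzv hzx hzy
    rcases (h1 z hz hzv hzx hzy).2 with h | h
    · exact h ▸ hv z hz hzv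
    · exact h ▸ Finset.mem_insert_self _ _
  have hxy' : f x y ∈ insert (f x y) ((S.erase v).image (f v)) := Finset.mem_insert_self _ _
  by_cases hpv : p = v
  · rw [hpv, hs v q]; exact hv q hq (by grind)
  by_cases hqv : q = v
  · rw [hqv]; exact hv p hp hpv
  by_cases hpx : p = x
  · by_cases hqy : q = y
    · rwa [hpx, hqy]
    · rw [hpx, hs x q]; exact hx q hq hqv (by grind) hqy
  by_cases hpy : p = y
  · by_cases hqx : q = x
    · rwa [hpy, hqx, hs y x]
    · rw [hpy, hs y q, ← (h1 q hq hqv hqx (by grind)).1]; exact hx q hq hqv hqx (by grind)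
  by_cases hqx : q = x
  · rw [hqx]; exact hx p hp hpv hpx hpy
  by_cases hqy : q = y
  · rw [hqy, ← (h1 p hp hpv hpx hpy).1]; exact hx p hp hpv hpx hpy
  rcases h2 p hp hpv hpx hpy q hq hqv hqx hqy hpq with h | h
  · exact h ▸ hx q hq hqv hqx hqy
  · exact h ▸ hv p hp hpv

/-- A colour lost on deleting `v` lives only on edges at `v`, so those edges are private to `v`. -/
theorem mem_edgeColors_erase_of_not_isPrivate {V C : Type*} [DecidableEq V] {f : V → V → C}
    {S : Finset V} {v : V} {a : C} (hs : ∀ x y, f x y = f y x) (ha : a ∈ edgeColors f S)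
    (h : ∀ z, IsPrivate f S v z → f v z ≠ a) : a ∈ edgeColors f (S.erase v) := by
  by_contra hcon
  obtain ⟨p, hp, q, hq, hpq, rfl⟩ := mem_edgeColors.1 ha
  have key : ∀ p' ∈ S, ∀ q' ∈ S, p' ≠ q' → f p' q' = f p q → p' = v ∨ q' = v := by
    intro p' hp' q' hq' hpq' e
    by_contra! h'
    exact hcon (mem_edgeColors.2 ⟨p', Finset.mem_erase.2 ⟨h'.1, hp'⟩, q',
      Finset.mem_erase.2 ⟨h'.2, hq'⟩, hpq', e⟩)
  rcases key p hp q hq hpq rfl with rfl | rfl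
  · exact h q ⟨hp, hq, hpq, key⟩ rfl
  · exact h p ⟨hq, hp, hpq.symm, fun p' hp' q' hq' n e => key p' hp' q' hq' n (e.trans (hs _ _))⟩
      (hs _ _)

/-- A colouring of a complete graph without properly coloured 4-cycles has at most as many
colours as vertices. -/
theorem NoProperC4.card_edgeColors_le {V C : Type*} {f : V → V → C}
    (hC : NoProperC4 f) (hs : ∀ x y, f x y = f y x) (S : Finset V) :
    (edgeColors f S).card ≤ S.card := by
  classical
  induction S using Finset.strongInduction with
  | H S ih =>
    rcases S.eq_empty_or_nonempty with rfl | hS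
    · simp [edgeColors]
    obtain ⟨v, hv, hsym⟩ := hC.exists_private_symm hs hS
    by_cases hone : ∃ x, ∀ z, IsPrivate f S v z → f v z = f v x
    · obtain ⟨x, hx⟩ := hone
      have hsub : edgeColors f S ⊆ insert (f v x) (edgeColors f (S.erase v)) := by
        intro a ha
        by_cases hax : a = f v x
        · exact hax ▸ Finset.mem_insert_self _ _
        · exact Finset.mem_insert_of_mem (mem_edgeColors_erase_of_not_isPrivate hs ha
            fun z hz e => hax (e.symm.trans (hx z hz)))
      have h1 := Finset.card_le_card hsub
      have h2 := Finset.card_insert_le (f v x) (edgeColors f (S.erase v))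
      have h3 := ih _ (Finset.erase_ssubset hv)
      have h4 := Finset.card_erase_add_one hv
      omega
    · push Not at hone
      -- The argument `v` is a dummy: only some private edge `vx` is wanted here.
      obtain ⟨x, hx, -⟩ := hone v
      obtain ⟨y, hy, hxy⟩ := hone x
      have hne : x ≠ y := by rintro rfl; exact hxy rfl
      have h1 := Finset.card_le_card
        (hC.edgeColors_subset_of_unique hs hne hx (hsym x hx) hy (hsym y hy))
      have h2 := Finset.card_insert_le (f x y) ((S.erase v).image (f v))
      have h3 := Finset.card_image_le (s := S.erase v) (f := f v)
      have h4 := Finset.card_erase_add_one hv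
      omega

/-! ### The equality case -/

/-- If the colour of `xy` occurs nowhere else and the colour of `qx` and `qy` occurs on no other
edges, then there are fewer colours than vertices. -/
theorem NoProperC4.card_edgeColors_lt_of_triangle {V C : Type*} {f : V → V → C} {S : Finset V}
    (hC : NoProperC4 f) (hs : ∀ x y, f x y = f y x) {x y q : V}
    (hxy : IsPrivate f S x y) (hyx : IsPrivate f S y x) (hq : q ∈ S) (hqx : q ≠ x) (hqy : q ≠ y)
    (hqxy : f q x = f q y)
    (honly : ∀ p ∈ S, ∀ r ∈ S, p ≠ r → f p r = f q x →
      (p = q ∧ (r = x ∨ r = y)) ∨ (r = q ∧ (p = x ∨ p = y))) :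
    (edgeColors f S).card < S.card := by
  classical
  have hx := hxy.1
  have hy := hxy.2.1
  have nxy := hxy.2.2.1
  have uxy : ∀ p r, p ∈ S → r ∈ S → p ≠ r → f p r = f x y → _ :=
    fun p r hp hr hpr => hxy.unique hyx hs hp hr hpr
  -- In the cycles `wqxy` and `wqyx` only the two edges at `w` can agree.
  have key : ∀ w ∈ S, w ≠ x → w ≠ y → w ≠ q → f w x = f w q ∧ f w y = f w q := by
    intro w hw wx wy wq
    have e1 := honly w hw q hq wq
    have e2 := uxy q x hq hx hqx
    have e3 := uxy q y hq hy hqy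
    have e4 := uxy y w hy hw wy.symm
    have e5 := uxy x w hx hw wx.symm
    have s1 := hs x y
    have s2 := hs y w
    have s3 := hs x w
    have c1 := hC w q x y wq wx wy hqx hqy nxy
    have c2 := hC w q y x wq wy wx hqy hqx nxy.symm
    grind
  have hww : ∀ w ∈ S, w ≠ x → w ≠ y → w ≠ q → ∀ w' ∈ S, w' ≠ x → w' ≠ y → w' ≠ q → w ≠ w' →
      f w w' = f w x ∨ f w w' = f w' x := by
    intro w hw wx wy wq w' hw' wx' wy' wq' n
    have c := hC w w' x y n wx wy wx' wy' nxy
    have e1 := uxy w' x hw' hx wx'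
    have e2 := uxy y w hy hw wy.symm
    have k := key w hw wx wy wq
    have s2 := hs y w
    grind
  -- Two colours inside the triangle and at most one per further vertex: at most `2 + (|S| - 3)`.
  have hsub : edgeColors f S ⊆
      insert (f x y) (insert (f q x) ((((S.erase x).erase y).erase q).image fun w => f w x)) := by
    have hwx : ∀ w ∈ S, w ≠ x → w ≠ y → w ≠ q → f w x ∈
        insert (f x y) (insert (f q x) ((((S.erase x).erase y).erase q).image fun w => f w x)) := by
      intro w hw wx wy wq
      refine Finset.mem_insert_of_mem (Finset.mem_insert_of_mem (Finset.mem_image.2 ⟨w, ?_, rfl⟩))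
      simp [hw, wx, wy, wq]
    have hin : ∀ w ∈ S, w ≠ x → w ≠ y → w ≠ q → ∀ t ∈ S, w ≠ t → f w t ∈
        insert (f x y) (insert (f q x) ((((S.erase x).erase y).erase q).image fun w => f w x)) := by
      intro w hw wx wy wq t ht hwt
      have k := key w hw wx wy wq
      by_cases ht' : t = x ∨ t = y ∨ t = q
      · have : f w t = f w x := by grind
        exact this ▸ hwx w hw wx wy wq
      · push Not at ht'
        rcases hww w hw wx wy wq t ht ht'.1 ht'.2.1 ht'.2.2 hwt with h | h
        · exact h ▸ hwx w hw wx wy wq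
        · exact h ▸ hwx t ht ht'.1 ht'.2.1 ht'.2.2
    intro a ha
    obtain ⟨p, hp, r, hr, hpr, rfl⟩ := mem_edgeColors.1 ha
    by_cases hp' : p = x ∨ p = y ∨ p = q
    · by_cases hr' : r = x ∨ r = y ∨ r = q
      · have s1 := hs x y
        have s2 := hs x q
        have s3 := hs y q
        have : f p r = f x y ∨ f p r = f q x := by grind
        rcases this with h | h <;> simp [h]
      · push Not at hr'
        rw [hs p r]
        exact hin r hr hr'.1 hr'.2.1 hr'.2.2 p hp hpr.symm
    · push Not at hp'
      exact hin p hp hp'.1 hp'.2.1 hp'.2.2 r hr hpr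
  have h1 := Finset.card_le_card hsub
  have h2 := Finset.card_insert_le (f x y)
    (insert (f q x) ((((S.erase x).erase y).erase q).image fun w => f w x))
  have h3 := Finset.card_insert_le (f q x) ((((S.erase x).erase y).erase q).image fun w => f w x)
  have h4 := Finset.card_image_le (s := ((S.erase x).erase y).erase q) (f := fun w => f w x)
  have h5 := Finset.card_erase_add_one hx
  have h6 := Finset.card_erase_add_one (Finset.mem_erase.2 ⟨nxy.symm, hy⟩)
  have h7 := Finset.card_erase_add_one
    (Finset.mem_erase.2 ⟨hqy, Finset.mem_erase.2 ⟨hqx, hq⟩⟩)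
  omega

/-- If there are exactly as many colours as vertices, two edges with a common endpoint have colours
occurring nowhere else. -/
theorem NoProperC4.exists_two_unique {V C : Type*} {f : V → V → C} {S : Finset V}
    (hC : NoProperC4 f) (hs : ∀ x y, f x y = f y x) (hS : S.Nonempty)
    (hcard : (edgeColors f S).card = S.card) :
    ∃ v x y, x ≠ y ∧ IsPrivate f S v x ∧ IsPrivate f S x v ∧
      IsPrivate f S v y ∧ IsPrivate f S y v := by
  classical
  have hpriv : ∀ v ∈ S, ∃ z, IsPrivate f S v z := by
    intro v hv
    by_contra! h
    have h1 := Finset.card_le_card (fun a ha => mem_edgeColors_erase_of_not_isPrivate hs ha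
      fun z hz => absurd hz (h z) : edgeColors f S ⊆ edgeColors f (S.erase v))
    have h2 := hC.card_edgeColors_le hs (S.erase v)
    have h4 := Finset.card_erase_add_one hv
    omega
  by_contra! hno
  have huniq : ∀ v x y, IsPrivate f S v x → IsPrivate f S x v → IsPrivate f S v y →
      IsPrivate f S y v → x = y := by
    intro v x y h1 h2 h3 h4
    by_contra hne
    exact hno v x y hne h1 h2 h3 h4
  obtain ⟨x, hx, hsym⟩ := hC.exists_private_symm hs hS
  obtain ⟨y, hxy⟩ := hpriv x hx
  have hyx := hsym y hxy
  -- the only private edge at either end of `xy` is `xy`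
  have hxo : ∀ z, IsPrivate f S x z → z = y := fun z hz =>
    huniq x z y hz (hsym z hz) hxy hyx
  -- Otherwise the shortcut of a path `x, y, z, t` would repeat the unique colour of `xy`, so all
  -- private edges at `z` go to `x`; the colour of `zx` is then unique, making `xz` a second private
  -- edge at `x`.
  have hyo : ∀ z, IsPrivate f S y z → z = x := by
    intro z hz
    by_contra hzx
    have hzy : ¬ IsPrivate f S z y := fun h => hzx (huniq y z x hz h hyx hxy)
    obtain ⟨t, ht⟩ := hpriv z hz.2.1
    have hzo : ∀ t, IsPrivate f S z t → t = x := by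
      intro t ht
      have hty : t ≠ y := by rintro rfl; exact hzy ht
      by_contra htx
      have e := hC.color_eq_of_path hs hxy hz ht (Ne.symm hzx) (Ne.symm htx) hty.symm
      have := hxy.unique hyx hs hxy.1 ht.2.1 (Ne.symm htx) e
      grind
    obtain rfl := hzo t ht
    refine hz.2.2.1 (hxo z ⟨hxy.1, hz.2.1, Ne.symm hzx, fun p hp r hr hpr e => ?_⟩).symm
    have e' : f p r = f z t := e.trans (hs t z)
    rcases ht.2.2.2 p hp r hr hpr e' with rfl | rfl
    · exact Or.inr (hzo r (ht.of_color_eq hr hpr e'))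
    · exact Or.inl (hzo p (ht.of_color_eq hp hpr.symm ((hs _ _).trans e')))
  -- Deleting both `x` and `y` would cost one colour only, contradicting the bound on `|S| - 2`
  -- vertices.
  have hsub : edgeColors f S ⊆ insert (f x y) (edgeColors f ((S.erase x).erase y)) := by
    intro a ha
    by_contra hcon
    rw [Finset.mem_insert, not_or] at hcon
    obtain ⟨hax, hcon⟩ := hcon
    have hmeet : ∀ p ∈ S, ∀ r ∈ S, p ≠ r → f p r = a → p = x ∨ p = y ∨ r = x ∨ r = y := by
      intro p hp r hr hpr e
      by_contra! h
      exact hcon (mem_edgeColors.2 ⟨p, by simp [hp, h], r, by simp [hr, h], hpr, e⟩)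
    have hx' : a ∈ edgeColors f (S.erase x) := mem_edgeColors_erase_of_not_isPrivate hs ha
      fun z hz e => hax (by rw [← e, hxo z hz])
    have hy' : a ∈ edgeColors f (S.erase y) := mem_edgeColors_erase_of_not_isPrivate hs ha
      fun z hz e => hax (by rw [← e, hyo z hz, hs])
    have ex : ∃ p ∈ S, p ≠ x ∧ p ≠ y ∧ f p x = a := by
      obtain ⟨p, hp, r, hr, hpr, e⟩ := mem_edgeColors.1 hy'
      rw [Finset.mem_erase] at hp hr
      have := hmeet p hp.2 r hr.2 hpr e
      have := hs p r
      grind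
    have ey : ∃ p ∈ S, p ≠ x ∧ p ≠ y ∧ f p y = a := by
      obtain ⟨p, hp, r, hr, hpr, e⟩ := mem_edgeColors.1 hx'
      rw [Finset.mem_erase] at hp hr
      have := hmeet p hp.2 r hr.2 hpr e
      have := hs p r
      grind
    -- Otherwise the cycle `xyqp` is proper: `yq` and `px` have colour `a`, the other two edges do
    -- not.
    have hpq : ∀ p ∈ S, p ≠ x → p ≠ y → f p x = a → ∀ q ∈ S, q ≠ x → q ≠ y → f q y = a →
        p = q := by
      intro p hp px py ep q hq qx qy eq
      by_contra hne
      have c := hC x y q p hxy.2.2.1 qx.symm px.symm qy.symm py.symm (Ne.symm hne)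
      have m := hmeet q hq p hp (Ne.symm hne)
      have := hs y q
      grind
    obtain ⟨p, hp, px, py, ep⟩ := ex
    obtain ⟨q, hq, qx, qy, eq⟩ := ey
    obtain rfl := hpq p hp px py ep q hq qx qy eq
    refine (hC.card_edgeColors_lt_of_triangle hs hxy hyx hp px py (ep.trans eq.symm) ?_).ne hcard
    intro r hr t ht hrt e
    rw [ep] at e
    have m := hmeet r hr t ht hrt e
    have k1 : ∀ s ∈ S, s ≠ x → s ≠ y → f s x = a → s = p :=
      fun s h1 h2 h3 h4 => hpq s h1 h2 h3 h4 p hp px py eq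
    have k2 : ∀ s ∈ S, s ≠ x → s ≠ y → f s y = a → s = p :=
      fun s h1 h2 h3 h4 => (hpq p hp px py ep s h1 h2 h3 h4).symm
    have s1 := hs r t
    have s2 := hs x y
    grind
  have h1 := Finset.card_le_card hsub
  have h2 := Finset.card_insert_le (f x y) (edgeColors f ((S.erase x).erase y))
  have h3 := hC.card_edgeColors_le hs ((S.erase x).erase y)
  have h4 := Finset.card_erase_add_one hx
  have h5 := Finset.card_erase_add_one (Finset.mem_erase.2 ⟨hxy.2.2.1.symm, hxy.2.1⟩)
  omega

/-! ### Tail-coloured tournaments -/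

/-- A colouring of a tournament in which every edge has the colour assigned to its tail, without
properly coloured 4-cycles, has a source or a cyclic triangle dominating all other vertices. -/
theorem NoProperC4.exists_source_or_triangle {V C : Type*} {f : V → V → C} {g : V → C}
    {T : Finset V} (hC : NoProperC4 f) (hs : ∀ x y, f x y = f y x) (hT : T.Nonempty)
    (hg : ∀ x ∈ T, ∀ y ∈ T, g x = g y → x = y)
    (hfg : ∀ x ∈ T, ∀ y ∈ T, x ≠ y → f x y = g x ∨ f x y = g y) :
    (∃ v ∈ T, ∀ w ∈ T, w ≠ v → f v w = g v) ∨
    ∃ u ∈ T, ∃ v ∈ T, ∃ w ∈ T, u ≠ v ∧ v ≠ w ∧ u ≠ w ∧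
      f u v = g u ∧ f v w = g v ∧ f w u = g w ∧
      ∀ z ∈ T, z ≠ u → z ≠ v → z ≠ w → f u z = g u ∧ f v z = g v ∧ f w z = g w := by
  classical
  let I : V → Finset V := fun v => T.filter fun z => z ≠ v ∧ f z v = g z
  have hI : ∀ v z, z ∈ I v ↔ z ∈ T ∧ z ≠ v ∧ f z v = g z := fun v z => by simp [I]
  have hasymm : ∀ x ∈ T, ∀ y ∈ T, x ∈ I y → y ∉ I x := by
    intro x hx y hy h h'
    rw [hI] at h h'
    exact h.2.1 (hg x hx y hy (by rw [← h.2.2, ← h'.2.2, hs]))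
  have htotal : ∀ x ∈ T, ∀ y ∈ T, x ≠ y → x ∉ I y → y ∈ I x := by
    intro x hx y hy n h
    rw [hI] at h ⊢
    have := hfg x hx y hy n
    have := hs x y
    grind
  have hout : ∀ x ∈ T, ∀ y ∈ T, x ≠ y → y ∉ I x → f x y = g x :=
    fun x hx y hy n h => ((hI _ _).1 (htotal y hy x hx n.symm h)).2.2
  -- A directed 4-cycle would carry four distinct tail colours.
  have hpath : ∀ v₁ v₂ v₃ v₄, v₄ ∈ T → v₁ ∈ I v₂ → v₂ ∈ I v₃ → v₃ ∈ I v₄ → v₁ ≠ v₄ → v₂ ≠ v₄ →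
      v₁ ∈ I v₄ := by
    intro v₁ v₂ v₃ v₄ h4 k1 k2 k3 n14 n24
    rw [hI] at k1 k2 k3 ⊢
    have n13 : v₁ ≠ v₃ := by
      rintro rfl
      exact k1.2.1 (hg _ k1.1 _ k2.1 (by rw [← k1.2.2, ← k2.2.2, hs]))
    have c := hC v₁ v₂ v₃ v₄ k1.2.1 n13 n14 k2.2.1 n24 k3.2.1
    have e1 := hg v₁ k1.1 v₂ k2.1
    have e2 := hg v₂ k2.1 v₃ k3.1
    have e3 := hg v₃ k3.1 v₁ k1.1
    have e4 := hg v₃ k3.1 v₄ h4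
    have e5 := hfg v₁ k1.1 v₄ h4 n14
    have := hs v₁ v₄
    grind
  obtain ⟨v, hv, hmin⟩ := T.exists_min_image (fun v => (I v).card) hT
  by_cases hnos : ∃ v ∈ T, I v = ∅
  · obtain ⟨s, hsT, hsI⟩ := hnos
    exact Or.inl ⟨s, hsT, fun w hw n => hout s hsT w hw n.symm (by simp [hsI])⟩
  right
  have hne : ∀ v ∈ T, ∃ z, z ∈ I v := fun v hv =>
    Finset.nonempty_iff_ne_empty.2 fun h => hnos ⟨v, hv, h⟩
  obtain ⟨u, hu⟩ := hne v hv
  have huT := ((hI _ _).1 hu).1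
  have hback : ∀ w, w ∈ I u → v ∈ I w ∧ (I w).erase v = (I v).erase u := by
    intro w hw
    have hwT := ((hI _ _).1 hw).1
    have hsub : (I w).erase v ⊆ (I v).erase u := by
      intro t ht
      obtain ⟨htv, ht⟩ := Finset.mem_erase.1 ht
      have hwv : w ≠ v := by rintro rfl; exact hasymm u huT w hwT hu hw
      have htu : t ≠ u := by rintro rfl; exact hasymm w hwT t huT hw ht
      exact Finset.mem_erase.2 ⟨htu, hpath t w u v hv ht hw hu htv hwv⟩
    have hle := hmin w hwT
    have hpos := Finset.card_pos.2 ⟨u, hu⟩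
    have hvw : v ∈ I w := by
      by_contra hvw
      have := Finset.card_le_card hsub
      rw [Finset.erase_eq_of_notMem hvw, Finset.card_erase_of_mem hu] at this
      omega
    refine ⟨hvw, Finset.eq_of_subset_of_card_le hsub ?_⟩
    rw [Finset.card_erase_of_mem hu, Finset.card_erase_of_mem hvw]
    omega
  obtain ⟨w, hw⟩ := hne u huT
  have hwT := ((hI _ _).1 hw).1
  have hvw := (hback w hw).1
  have hIv : ∀ z ∈ I v, z = u := by
    intro z hz
    by_contra hzu
    have hzw : z ∈ I w :=
      Finset.mem_of_mem_erase ((hback w hw).2 ▸ Finset.mem_erase.2 ⟨hzu, hz⟩)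
    have hzT := ((hI _ _).1 hz).1
    have hwv : v ≠ u := ((hI _ _).1 hu).2.1.symm
    have hzu' : z ∈ I u := hpath z v w u huT hz hvw hw hzu hwv
    exact hasymm z hzT v hv hz (hback z hzu').1
  have hIw : ∀ w', w' ∈ I u → ∀ z ∈ I w', z = v := by
    intro w' hw' z hz
    by_contra hzv
    have : z ∈ (I v).erase u := (hback w' hw').2 ▸ Finset.mem_erase.2 ⟨hzv, hz⟩
    exact (Finset.mem_erase.1 this).1 (hIv z (Finset.mem_erase.1 this).2)
  have hIu : ∀ z ∈ I u, z = w := by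
    intro z hz
    by_contra hzw
    have hzT := ((hI _ _).1 hz).1
    have h1 : z ∉ I w := fun h => hasymm u huT v hv hu ((hIw w hw z h) ▸ hz)
    have h2 := htotal z hzT w hwT hzw h1
    exact hasymm u huT v hv hu ((hIw z hz w h2) ▸ hw)
  have k1 := (hI _ _).1 hu
  have k2 := (hI _ _).1 hw
  have k3 := (hI _ _).1 hvw
  refine ⟨u, huT, v, hv, w, hwT, k1.2.1, k3.2.1, k2.2.1.symm, k1.2.2, k3.2.2, k2.2.2,
    fun z hz zu zv zw => ⟨hout u huT z hz zu.symm fun h => zw (hIu z h),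
      hout v hv z hz zv.symm fun h => zu (hIv z h),
      hout w hwT z hz zw.symm fun h => zv (hIw w hw z h)⟩⟩

/-! ### The three structures -/

/-- The structure of colourings of a complete graph with as many colours as vertices and without
properly coloured 4-cycles. -/
theorem NoProperC4.trichotomy {V C : Type*} {f : V → V → C} {S : Finset V}
    (hC : NoProperC4 f) (hs : ∀ x y, f x y = f y x) (hS : S.Nonempty)
    (hcard : (edgeColors f S).card = S.card) :
    (∃ v ∈ S, ∃ a, ∀ w ∈ S, w ≠ v → f v w = a) ∨
    (∃ u ∈ S, ∃ v ∈ S, ∃ w ∈ S, u ≠ v ∧ v ≠ w ∧ u ≠ w ∧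
      f u v ≠ f v w ∧ f v w ≠ f u w ∧ f u v ≠ f u w ∧
      ∀ z ∈ S, z ≠ u → z ≠ v → z ≠ w → f u z = f u v ∧ f v z = f v w ∧ f w z = f u w) ∨
    ∃ v ∈ S, ∃ a, (∀ x ∈ S, ∀ y ∈ S, x ≠ v → y ≠ v → x ≠ y → f v x ≠ f v y) ∧
      (∀ x ∈ S, ∀ y ∈ S, x ≠ y → x ≠ v → y ≠ v → f x y = a) ∧
      ∀ x ∈ S, x ≠ v → f v x ≠ a := by
  classical
  obtain ⟨v, x, y, hxy, hvx, hxv, hvy, hyv⟩ := hC.exists_two_unique hs hS hcard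
  obtain ⟨h1, h2⟩ := hC.structure_of_unique hs hxy hvx hxv hvy hyv
  have hsub := Finset.card_le_card (hC.edgeColors_subset_of_unique hs hxy hvx hxv hvy hyv)
  have hv := hvx.1
  have hle := Finset.card_image_le (s := S.erase v) (f := f v)
  have hS' := Finset.card_erase_add_one hv
  have hnot : f x y ∉ (S.erase v).image (f v) := by
    intro h
    rw [Finset.insert_eq_of_mem h] at hsub
    omega
  rw [Finset.card_insert_of_notMem hnot] at hsub
  have hinj : Set.InjOn (f v) (S.erase v) := Finset.card_image_iff.1 (by omega)
  have hinj' : ∀ p ∈ S, ∀ q ∈ S, p ≠ v → q ≠ v → f p v = f q v → p = q := by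
    intro p hp q hq pv qv e
    exact hinj (by simp [hp, pv]) (by simp [hq, qv]) (by rw [hs v p, hs v q, e])
  have hnot' : ∀ p ∈ S, p ≠ v → f p v ≠ f x y := fun p hp pv e =>
    hnot (Finset.mem_image.2 ⟨p, by simp [hp, pv], (hs v p).trans e⟩)
  let T : Finset V := S.filter fun w => w ≠ v ∧ w ≠ x ∧ w ≠ y ∧ f w x = f w v
  have hT : ∀ w, w ∈ T ↔ w ∈ S ∧ w ≠ v ∧ w ≠ x ∧ w ≠ y ∧ f w x = f w v := fun w => by simp [T]
  rcases T.eq_empty_or_nonempty with hT0 | hT0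
  · refine Or.inr (Or.inr ⟨v, hv, f x y, ?_, ?_, ?_⟩)
    · intro p hp q hq pv qv n e
      exact n (hinj' p hp q hq pv qv (by rw [hs p v, hs q v, e]))
    · have hno : ∀ w ∈ S, w ≠ v → w ≠ x → w ≠ y → f w x = f x y ∧ f w y = f x y := by
        intro w hw wv wx wy
        have k := h1 w hw wv wx wy
        have : w ∉ T := by simp [hT0]
        rw [hT] at this
        grind
      intro p hp q hq n pv qv
      have s1 := hs p q
      by_cases hpx : p = x ∨ p = y
      · have := hno q hq qv
        have := hs x y
        grind
      · push Not at hpx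
        by_cases hqx : q = x ∨ q = y
        · have := hno p hp pv
          grind
        · push Not at hqx
          -- Both orders of the pair leave `f x y` or a colour common to `pv` and `qv`, which
          -- injectivity excludes.
          have e1 := h2 p hp pv hpx.1 hpx.2 q hq qv hqx.1 hqx.2 n
          have e2 := h2 q hq qv hqx.1 hqx.2 p hp pv hpx.1 hpx.2 n.symm
          have e3 := hno p hp pv hpx.1 hpx.2
          have e4 := hno q hq qv hqx.1 hqx.2
          have e5 := hinj' p hp q hq pv qv
          grind
    · intro p hp pv
      rw [hs v p]
      exact hnot' p hp pv
  · have hdom : ∀ w ∈ T, ∀ z ∈ S, z ∉ T → f w z = f w v := by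
      intro w hw z hz hzT
      have hwz : w ≠ z := by rintro rfl; exact hzT hw
      rw [hT] at hw hzT
      obtain ⟨hwS, wv, wx, wy, e⟩ := hw
      by_cases hzv : z = v
      · rw [hzv]
      by_cases hzx : z = x
      · rw [hzx, e]
      by_cases hzy : z = y
      · rw [hzy, ← (h1 w hwS wv wx wy).1, e]
      have e1 := (h1 z hz hzv hzx hzy).2
      have e2 := h2 z hz hzv hzx hzy w hwS wv wx wy hwz.symm
      have e3 := h2 w hwS wv wx wy z hz hzv hzx hzy hwz
      have e4 := hnot' z hz hzv
      have s := hs w z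
      grind
    have hfg : ∀ p ∈ T, ∀ q ∈ T, p ≠ q → f p q = f p v ∨ f p q = f q v := by
      intro p hp q hq n
      rw [hT] at hp hq
      have := h2 p hp.1 hp.2.1 hp.2.2.1 hp.2.2.2.1 q hq.1 hq.2.1 hq.2.2.1 hq.2.2.2.1 n
      grind
    have hgT : ∀ p ∈ T, ∀ q ∈ T, f p v = f q v → p = q := by
      intro p hp q hq
      rw [hT] at hp hq
      exact hinj' p hp.1 q hq.1 hp.2.1 hq.2.1
    have hTS : ∀ p ∈ T, p ∈ S := fun p hp => ((hT p).1 hp).1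
    rcases hC.exists_source_or_triangle (g := fun w => f w v) hs hT0 hgT hfg with
      ⟨w, hw, h⟩ | ⟨p, hp, q, hq, r, hr, npq, nqr, npr, epq, eqr, erp, h⟩
    · refine Or.inl ⟨w, hTS w hw, f w v, fun z hz n => ?_⟩
      by_cases hzT : z ∈ T
      · exact h z hzT n
      · exact hdom w hw z hz hzT
    · refine Or.inr (Or.inl ⟨p, hTS p hp, q, hTS q hq, r, hTS r hr, npq, nqr, npr, ?_⟩)
      have i1 := hgT p hp q hq
      have i2 := hgT q hq r hr
      have i3 := hgT p hp r hr
      rw [hs p r, epq, eqr, erp]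
      refine ⟨fun e => npq (i1 e), fun e => nqr (i2 e), fun e => npr (i3 e), ?_⟩
      intro z hz zp zq zr
      by_cases hzT : z ∈ T
      · exact h z hzT zp zq zr
      · exact ⟨hdom p hp z hz hzT, hdom q hq z hz hzT, hdom r hr z hz hzT⟩

/-! ### Translation to edge labellings -/

/-- The 4-cycle `abcd` is properly coloured if consecutive edges have different colours. -/
theorem containsProperlyColoredC4_of_cycle {V C : Type*} (c : SimpleGraph.TopEdgeLabeling V C)
    (f : V → V → C) (hs : ∀ x y, f x y = f y x)
    (hf : ∀ (x y : V) (h : x ≠ y), c.get x y h = f x y) {a b d e : V}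
    (hab : a ≠ b) (had : a ≠ d) (hae : a ≠ e) (hbd : b ≠ d) (hbe : b ≠ e) (hde : d ≠ e)
    (h1 : f a b ≠ f b d) (h2 : f b d ≠ f d e) (h3 : f d e ≠ f e a) (h4 : f e a ≠ f a b) :
    ContainsProperlyColoredC4 c := by
  let φ : Fin 4 → V := ![a, b, d, e]
  have hφ : Function.Injective φ := by
    intro i j
    fin_cases i <;> fin_cases j <;> simp_all [φ, eq_comm]
  let K : SimpleGraph.Copy (SimpleGraph.cycleGraph 4) (⊤ : SimpleGraph V) :=
    ⟨⟨φ, fun {i j} h => fun e => h.ne (hφ e)⟩, hφ⟩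
  refine ⟨K.toSubgraph, ⟨K.isoToSubgraph⟩, ?_⟩
  have hadj : ∀ p q : V, K.toSubgraph.Adj p q →
      s(p, q) = s(a, b) ∨ s(p, q) = s(b, d) ∨ s(p, q) = s(d, e) ∨ s(p, q) = s(e, a) := by
    rintro p q ⟨i, j, hij, rfl, rfl⟩
    have hij' : (SimpleGraph.cycleGraph 4).Adj i j := hij
    rw [SimpleGraph.cycleGraph_adj] at hij'
    change s(φ i, φ j) = _ ∨ s(φ i, φ j) = _ ∨ s(φ i, φ j) = _ ∨ s(φ i, φ j) = _
    revert hij'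
    fin_cases i <;> fin_cases j <;> first
    | exact fun h => absurd h (by decide)
    | simp [φ]
  rintro ⟨p, hp⟩ ⟨q, hq⟩
  induction p using Sym2.ind with | _ p₁ p₂
  induction q using Sym2.ind with | _ q₁ q₂
  intro hp' hq' hne ⟨z, hz, hz'⟩
  have e1 : c ⟨s(p₁, p₂), hp⟩ = f p₁ p₂ := hf p₁ p₂ hp
  have e2 : c ⟨s(q₁, q₂), hq⟩ = f q₁ q₂ := hf q₁ q₂ hq
  rw [e1, e2]
  have a1 := hadj p₁ p₂ hp'
  have a2 := hadj q₁ q₂ hq'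
  have hne' : s(p₁, p₂) ≠ s(q₁, q₂) := fun h => hne (Subtype.ext h)
  simp only [Sym2.mem_iff] at hz hz'
  have lift : ∀ p q r s : V, s(p, q) = s(r, s) → f p q = f r s := by
    intro p q r s h
    rcases Sym2.eq_iff.1 h with ⟨rfl, rfl⟩ | ⟨rfl, rfl⟩
    · rfl
    · exact hs _ _
  -- Two edges of the cycle are equal, consecutive, or opposite and then without a common vertex.
  rcases a1 with a1 | a1 | a1 | a1 <;> rcases a2 with a2 | a2 | a2 | a2 <;>
    rw [lift _ _ _ _ a1, lift _ _ _ _ a2] <;> rw [a1, a2] at hne' <;>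
    first
    | exact absurd rfl hne'
    | assumption
    | (symm; assumption)
    | (exfalso; rw [Sym2.eq_iff] at a1 a2; grind)

theorem theorem5 {V C : Type*} [Fintype V] [Nonempty V]
    (c : SimpleGraph.TopEdgeLabeling V C)
    (hn : numColors c = Fintype.card V)
    (hC4 : ¬ ContainsProperlyColoredC4 c) :
    HasMonochromaticVertex c ∨ HasRainbowTriangleStructure c ∨ HasRainbowStarStructure c := by
  classical
  obtain ⟨d⟩ : Nonempty C := by
    by_contra hemp
    rw [not_nonempty_iff] at hemp
    have hpos : 0 < Fintype.card V := Fintype.card_pos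
    rw [← hn, numColors, Set.eq_empty_of_isEmpty (Set.range c), Set.ncard_empty] at hpos
    exact hpos.false
  -- The value `d` on the diagonal is never used as an edge colour.
  let f : V → V → C := fun x y => if h : x ≠ y then c.get x y h else d
  have hf : ∀ (x y : V) (h : x ≠ y), c.get x y h = f x y := fun x y h => by simp [f, h]
  have hs : ∀ x y, f x y = f y x := by
    intro x y
    by_cases h : x = y
    · rw [h]
    · rw [← hf x y h, ← hf y x (Ne.symm h)]
      exact SimpleGraph.EdgeLabeling.get_comm y x h
  have hC : NoProperC4 f := by
    intro p q r s h1 h2 h3 h4 h5 h6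
    by_contra! hcon
    exact hC4 (containsProperlyColoredC4_of_cycle c f hs hf h1 h2 h3 h4 h5 h6
      hcon.1 hcon.2.1 hcon.2.2.1 hcon.2.2.2)
  have hrange : Set.range c = (edgeColors f Finset.univ : Set C) := by
    ext a
    rw [Finset.mem_coe, mem_edgeColors]
    constructor
    · rintro ⟨⟨p, hp⟩, rfl⟩
      induction p using Sym2.ind with | _ x y
      exact ⟨x, Finset.mem_univ _, y, Finset.mem_univ _, hp, (hf x y hp).symm⟩
    · rintro ⟨x, -, y, -, h, rfl⟩
      exact ⟨⟨s(x, y), h⟩, hf x y h⟩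
  have hcard : (edgeColors f Finset.univ).card = (Finset.univ : Finset V).card := by
    rw [← Set.ncard_coe_finset, ← hrange, Finset.card_univ]
    exact hn
  rcases hC.trichotomy hs Finset.univ_nonempty hcard with
    ⟨v, -, a, h⟩ | ⟨u, -, v, -, w, -, huv, hvw, huw, n1, n2, n3, h⟩ | ⟨v, -, a, h1, h2, h3⟩
  · exact Or.inl ⟨v, a, fun x hx => (hf v x hx).trans (h x (Finset.mem_univ _) (Ne.symm hx))⟩
  · exact Or.inr (Or.inl ⟨u, v, w, huv, hvw, huw, f u v, f v w, f u w, n1, n2, n3,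
      hf _ _ _, hf _ _ _, hf _ _ _,
      fun x hx xv xw => (hf u x hx).trans (h x (Finset.mem_univ _) (Ne.symm hx) xv xw).1,
      fun x hx xu xw => (hf v x hx).trans (h x (Finset.mem_univ _) xu (Ne.symm hx) xw).2.1,
      fun x hx xu xv => (hf w x hx).trans (h x (Finset.mem_univ _) xu xv (Ne.symm hx)).2.2⟩)
  · refine Or.inr (Or.inr ⟨v, a, fun x y hx hy n => ?_, fun x y n xv yv => ?_, fun x hx => ?_⟩)
    · rw [hf, hf]
      exact h1 x (Finset.mem_univ _) y (Finset.mem_univ _) (Ne.symm hx) (Ne.symm hy) n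
    · rw [hf]
      exact h2 x (Finset.mem_univ _) y (Finset.mem_univ _) n xv yv
    · rw [hf]
      exact h3 x (Finset.mem_univ _) (Ne.symm hx)
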